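/- Let $K$ be a field, let $n\ge 2$ and $k\ge 1$ be integers, and let $S=K[x_1,\dots,x_n]$ with its standard $\mathbb{Z}^n$-grading. Let $P_n^k$ be the $k$-th power of the path on $n$ vertices, that is, the graph on $\{1,\dots,n\}$ in which $i<j$ are adjacent if and only if $j-i\le k$, and let $I=I(P_n^k)=(x_ix_j : 1\le i<j\le n,\ j-i\le k)\subset S$ be its edge ideal. For a nonzero finitely generated $\mathbb{Z}^n$-graded $S$-module $M$, a Stanley decomposition of $M$ is a presentation of $M$ as a finite direct sum of $K$-subspaces $M=\bigoplus_{i=1}^{s}v_iK[W_i]$, where each $v_i\in M$ is homogeneous, $W_i\subseteq\{x_1,\dots,x_n\}$, $v_iK[W_i]$ is the $K$-span of all $v_iw$ with $w$ a monomial in $K[W_i]$, and no nonzero element of $K[W_i]$ annihilates $v_i$ (so that $v_iK[W_i]$ is a free $K[W_i]$-module with basis $v_i$). The Stanley depth $\operatorname{sdepth}(M)$ is the maximum of $\min_i|W_i|$ over all Stanley decompositions of $M$. Then $$\operatorname{sdepth}(I)\ \ge\ \left\lceil\frac{n}{2k+1}\right\rceil+1 .$$ Moreover, Herzog's conjecture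 holds for these ideals: $$\operatorname{sdepth}(I)\ \ge\ \operatorname{sdepth}(S/I).$$ -/

import Mathlib

namespace StanleyDepth

open MvPolynomial

section Module

variable {K : Type*} [Field K] {n : ℕ} {M : Type*} [AddCommGroup M] [Module K M]
  [Module (MvPolynomial (Fin n) K) M]

/-- The `K`-subspace `v K[W]` of a module over `S = K[x₁, …, xₙ]`: it is generated by all elements
`w • v`, where `w` is a monomial in the variables from `W`. -/
def stanleySpace (v : M) (W : Finset (Fin n)) : Submodule K M :=
  Submodule.span K {y | ∃ m : Fin n →₀ ℕ, m.support ⊆ W ∧ y = (monomial m (1 : K)) • v}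

/-- A Stanley decomposition of a `ℤⁿ`-graded `S`-module `M` whose component of degree `a` is `𝓜 a`:
a presentation of the `K`-space `M` as a finite direct sum of Stanley spaces `vᵢ K[Wᵢ]`
with `vᵢ` homogeneous and `vᵢ K[Wᵢ]` free over `K[Wᵢ]` (with basis `vᵢ`, that is, no nonzero
element of `K[Wᵢ]` kills `vᵢ`). -/
structure StanleyDecomposition (𝓜 : (Fin n → ℤ) → Submodule K M) where
  /-- number of Stanley spaces -/
  s : ℕ
  /-- the generators -/
  v : Fin s → M
  /-- the sets of variables -/
  W : Fin s → Finset (Fin n)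
  homogeneous : ∀ i, ∃ a, v i ∈ 𝓜 a
  free : ∀ i, ∀ p ∈ supported K (W i : Set (Fin n)), p • v i = 0 → p = 0
  isInternal : DirectSum.IsInternal fun i => stanleySpace (K := K) (v i) (W i)

/-- The Stanley depth of a decomposition: the least `|Wᵢ|` (`⊤` for the empty decomposition, which
occurs only for the zero module). -/
noncomputable def StanleyDecomposition.sdepth {𝓜 : (Fin n → ℤ) → Submodule K M}
    (D : StanleyDecomposition 𝓜) : ℕ∞ :=
  ⨅ i, ((D.W i).card : ℕ∞)

/-- The Stanley depth of a `ℤⁿ`-graded module with components `𝓜 a`: the largest Stanley depth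
of a Stanley decomposition. For a nonzero module all these values are at most `n`. -/
noncomputable def stanleyDepth (𝓜 : (Fin n → ℤ) → Submodule K M) : ℕ∞ :=
  ⨆ D : StanleyDecomposition 𝓜, D.sdepth

end Module

section Gradings

variable {K : Type*} [Field K] {n : ℕ}

/-- The standard `ℤⁿ`-grading of `S = K[x₁, …, xₙ]`: the component of degree `a` is `K x^a` if `a`
has no negative entry, and `0` otherwise. -/
noncomputable def polyGrading (K : Type*) [Field K] (n : ℕ) (a : Fin n → ℤ) :
    Submodule K (MvPolynomial (Fin n) K) :=
  Submodule.span K {p | ∃ m : Fin n →₀ ℕ, (∀ i, (m i : ℤ) = a i) ∧ p = monomial m (1 : K)}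

/-- The grading induced on an ideal `I` of `S` (used for monomial ideals): `I_a = I ∩ S_a`. -/
noncomputable def idealGrading (I : Ideal (MvPolynomial (Fin n) K)) (a : Fin n → ℤ) :
    Submodule K I :=
  (polyGrading K n a).comap ((Submodule.subtype I).restrictScalars K)

/-- The grading induced on the quotient `S/I` (used for monomial ideals): `(S/I)_a` is the image
of `S_a`. -/
noncomputable def quotientGrading (I : Ideal (MvPolynomial (Fin n) K)) (a : Fin n → ℤ) :
    Submodule K (MvPolynomial (Fin n) K ⧸ I) :=
  (polyGrading K n a).map ((Submodule.mkQ I).restrictScalars K)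

end Gradings

/-- The `k`-th power `P_n^k` of the path on `n` vertices: for `i < j`, the vertices `i` and `j` are
adjacent if and only if `j - i ≤ k`. (The vertices `1, …, n` are numbered `0, …, n - 1` here.) -/
def pathPower (n k : ℕ) : SimpleGraph (Fin n) where
  Adj i j := (i.val < j.val ∧ j.val ≤ i.val + k) ∨ (j.val < i.val ∧ i.val ≤ j.val + k)
  symm := ⟨fun _ _ h => h.symm⟩
  loopless := ⟨fun _ h => by omega⟩

/-- The edge ideal `I(G) = (xᵢ xⱼ : {i, j} ∈ E(G))` in `K[x₁, …, xₙ]`. -/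
noncomputable def edgeIdeal (K : Type*) [Field K] {n : ℕ} (G : SimpleGraph (Fin n)) :
    Ideal (MvPolynomial (Fin n) K) :=
  Ideal.span {p | ∃ i j, G.Adj i j ∧ p = X i * X j}

end StanleyDepth

/-! Both ideals are handled through supports. A partition of the squarefree supports of the
monomials of I into intervals [A, B] gives the Stanley decomposition of I into the spaces x^A K[B],
so a lower bound needs only intervals with large upper ends
(`HasIntervalPartition.le_stanleyDepth`).

A support of a monomial in I contains an edge. Let d be its largest vertex that is the left end of
an edge, and e the other end of that edge. Beyond d the set is independent, so e is determined and
the remaining vertices start at e + k + 1. Vertices below d are free. Each piece is thus an interval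
of top size d + 2 joined with the independent sets of a shorter path
(`hasIntervalPartition_pathDepSets`). Those are partitioned by recursion, each vertex of an upper
end paying for at most 2k + 1 path vertices (`hasIntervalPartition_pathIndepSets`).

For Herzog's inequality, S/I is bounded above: if A is an independent dominating set, x^A is nonzero
in S/I but is killed by every variable outside A, so some Stanley space has at most |A| variables
(`stanleyDepth_quotient_le`). Vertices spaced 2k + 1 apart give such an A of size at most ⌈n / (2k +
1)⌉, one less than the lower bound for I. -/

namespace StanleyDepth

/-! ### Interval partitions: unions, joins, pullbacks -/

section IntervalPartition

variable {α : Type*}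

/-- A family of finite sets has an interval partition of depth at least `s` if it is a finite
disjoint union of intervals `[A, B]` of the lattice of finite sets with `s ≤ |B|`. -/
def HasIntervalPartition (𝓕 : Set (Finset α)) (s : ℕ) : Prop :=
  ∃ P : Finset (Finset α × Finset α),
    (∀ q ∈ P, q.1 ⊆ q.2 ∧ s ≤ q.2.card) ∧
    (∀ F, F ∈ 𝓕 ↔ ∃ q ∈ P, q.1 ⊆ F ∧ F ⊆ q.2) ∧
    ∀ F, ∀ q ∈ P, ∀ r ∈ P, q.1 ⊆ F → F ⊆ q.2 → r.1 ⊆ F → F ⊆ r.2 → q = r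

theorem HasIntervalPartition.mono {𝓕 : Set (Finset α)} {s t : ℕ}
    (h : HasIntervalPartition 𝓕 t) (hst : s ≤ t) : HasIntervalPartition 𝓕 s := by
  obtain ⟨P, h1, h2, h3⟩ := h
  exact ⟨P, fun q hq => ⟨(h1 q hq).1, hst.trans (h1 q hq).2⟩, h2, h3⟩

/-- A finite family is partitioned into its one-element intervals. -/
theorem hasIntervalPartition_singletons [DecidableEq α] {𝓕 : Set (Finset α)} (h𝓕 : 𝓕.Finite) {s : ℕ}
    (hs : ∀ F ∈ 𝓕, s ≤ F.card) : HasIntervalPartition 𝓕 s := by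
  refine ⟨h𝓕.toFinset.image fun F => (F, F), ?_, ?_, ?_⟩
  · simpa using hs
  · intro F
    simp only [Finset.mem_image, Set.Finite.mem_toFinset]
    constructor
    · exact fun h => ⟨_, ⟨F, h, rfl⟩, subset_rfl, subset_rfl⟩
    · rintro ⟨_, ⟨G, hG, rfl⟩, h1, h2⟩
      rwa [← h1.antisymm h2]
  · intro F q hq r hr h1 h2 h3 h4
    simp only [Finset.mem_image, Set.Finite.mem_toFinset] at hq hr
    obtain ⟨_, _, rfl⟩ := hq
    obtain ⟨_, _, rfl⟩ := hr
    exact congrArg₂ Prod.mk ((h1.antisymm h2).trans (h3.antisymm h4).symm)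
      ((h1.antisymm h2).trans (h3.antisymm h4).symm)

theorem hasIntervalPartition_Icc {a b : Finset α} (hab : a ⊆ b) :
    HasIntervalPartition {F | a ⊆ F ∧ F ⊆ b} b.card :=
  ⟨{(a, b)}, by simpa using hab, by simp, by simp_all⟩

/-- Interval partitions of the fibres of a map to a finite set combine to one of the family. -/
theorem HasIntervalPartition.biUnion {ι : Type*} (I : Finset ι) {𝓕 : Set (Finset α)}
    {𝓖 : ι → Set (Finset α)} {s : ℕ} (hcov : ∀ F, F ∈ 𝓕 ↔ ∃ i ∈ I, F ∈ 𝓖 i)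
    (hdisj : ∀ F, ∀ i ∈ I, ∀ j ∈ I, F ∈ 𝓖 i → F ∈ 𝓖 j → i = j)
    (h : ∀ i ∈ I, HasIntervalPartition (𝓖 i) s) : HasIntervalPartition 𝓕 s := by
  classical
  choose! P h1 h2 h3 using h
  refine ⟨I.biUnion P, ?_, ?_, ?_⟩
  · intro q hq
    obtain ⟨i, hi, hq⟩ := Finset.mem_biUnion.1 hq
    exact h1 i hi q hq
  · intro F
    rw [hcov]
    constructor
    · rintro ⟨i, hi, hF⟩
      obtain ⟨q, hq, h⟩ := (h2 i hi F).1 hF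
      exact ⟨q, Finset.mem_biUnion.2 ⟨i, hi, hq⟩, h⟩
    · rintro ⟨q, hq, h⟩
      obtain ⟨i, hi, hq⟩ := Finset.mem_biUnion.1 hq
      exact ⟨i, hi, (h2 i hi F).2 ⟨q, hq, h⟩⟩
  · intro F q hq r hr q1 q2 r1 r2
    obtain ⟨i, hi, hq⟩ := Finset.mem_biUnion.1 hq
    obtain ⟨j, hj, hr⟩ := Finset.mem_biUnion.1 hr
    obtain rfl := hdisj F i hi j hj ((h2 i hi F).2 ⟨q, hq, q1, q2⟩)
      ((h2 j hj F).2 ⟨r, hr, r1, r2⟩)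
    exact h3 i hi F q hq r hr q1 q2 r1 r2

theorem HasIntervalPartition.union {𝓕 𝓖 : Set (Finset α)} {s : ℕ}
    (hF : HasIntervalPartition 𝓕 s) (hG : HasIntervalPartition 𝓖 s) (h : Disjoint 𝓕 𝓖) :
    HasIntervalPartition (𝓕 ∪ 𝓖) s := by
  refine HasIntervalPartition.biUnion (Finset.univ : Finset Bool)
    (𝓖 := fun b => cond b 𝓕 𝓖) (by simp [or_comm]) ?_ (by simp [hF, hG])
  intro F i _ j _ hi hj
  have hFG : F ∈ 𝓕 → F ∉ 𝓖 := fun h1 h2 => Set.disjoint_left.1 h h1 h2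
  cases i <;> cases j <;> simp_all

/-- The product of an interval partition with an interval on a disjoint ground set. -/
theorem HasIntervalPartition.join [DecidableEq α] {𝓕 : Set (Finset α)} {s : ℕ} {U a b : Finset α}
    (h : HasIntervalPartition 𝓕 s) (hU : ∀ F ∈ 𝓕, F ⊆ U) (hab : a ⊆ b) (hb : Disjoint b U) :
    HasIntervalPartition {F | F ∩ U ∈ 𝓕 ∧ a ⊆ F ∧ F ⊆ b ∪ U} (s + b.card) := by
  obtain ⟨P, h1, h2, h3⟩ := h
  have hPU : ∀ q ∈ P, q.2 ⊆ U := fun q hq => hU _ ((h2 _).2 ⟨q, hq, (h1 q hq).1, subset_rfl⟩)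
  have hbU : ∀ x ∈ b, x ∉ U := fun x hx => Finset.disjoint_left.1 hb hx
  have key : ∀ q ∈ P, ∀ F, (q.1 ∪ a ⊆ F ∧ F ⊆ q.2 ∪ b) ↔
      ((q.1 ⊆ F ∩ U ∧ F ∩ U ⊆ q.2) ∧ a ⊆ F ∧ F ⊆ b ∪ U) := by
    intro q hq F
    have h2U := hPU q hq
    have h12 := (h1 q hq).1
    simp only [Finset.subset_iff, Finset.mem_union, Finset.mem_inter] at *
    grind
  refine ⟨P.image fun q => (q.1 ∪ a, q.2 ∪ b), ?_, ?_, ?_⟩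
  · intro q' hq'
    obtain ⟨q, hq, rfl⟩ := Finset.mem_image.1 hq'
    refine ⟨Finset.union_subset_union (h1 q hq).1 hab, ?_⟩
    rw [Finset.card_union_of_disjoint (Finset.disjoint_of_subset_left (hPU q hq) hb.symm)]
    exact Nat.add_le_add_right (h1 q hq).2 _
  · intro F
    simp only [Set.mem_ofPred_eq, h2, Finset.mem_image, exists_exists_and_eq_and]
    constructor
    · rintro ⟨⟨q, hq, h⟩, h'⟩
      exact ⟨q, hq, (key q hq F).2 ⟨h, h'⟩⟩
    · rintro ⟨q, hq, h⟩
      exact ⟨⟨q, hq, ((key q hq F).1 h).1⟩, ((key q hq F).1 h).2⟩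
  · intro F q' hq' r' hr' hq1 hq2 hr1 hr2
    obtain ⟨q, hq, rfl⟩ := Finset.mem_image.1 hq'
    obtain ⟨r, hr, rfl⟩ := Finset.mem_image.1 hr'
    have hq3 := ((key q hq F).1 ⟨hq1, hq2⟩).1
    have hr3 := ((key r hr F).1 ⟨hr1, hr2⟩).1
    rw [h3 _ q hq r hr hq3.1 hq3.2 hr3.1 hr3.2]

/-- Interval partitions can be pulled back along an embedding whose range covers the family. -/
theorem HasIntervalPartition.comap {β : Type*} [DecidableEq β] (f : α ↪ β)
    {𝓕 : Set (Finset β)} {s : ℕ} (h : HasIntervalPartition 𝓕 s)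
    (hf : ∀ F ∈ 𝓕, ∀ x ∈ F, x ∈ Set.range f) :
    HasIntervalPartition {F : Finset α | F.map f ∈ 𝓕} s := by
  classical
  obtain ⟨P, h1, h2, h3⟩ := h
  have hP2 : ∀ q ∈ P, ∀ x ∈ q.2, x ∈ Set.range f := fun q hq =>
    hf _ ((h2 _).2 ⟨q, hq, (h1 q hq).1, subset_rfl⟩)
  let g : Finset β → Finset α := fun F => F.preimage f f.injective.injOn
  have hg : ∀ F : Finset β, (∀ x ∈ F, x ∈ Set.range f) → (g F).map f = F := by
    intro F hF
    ext x
    simp only [g, Finset.mem_map, Finset.mem_preimage]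
    constructor
    · rintro ⟨y, hy, rfl⟩
      exact hy
    · intro hx
      obtain ⟨y, rfl⟩ := hF x hx
      exact ⟨y, hx, rfl⟩
  have hg1 : ∀ q ∈ P, (g q.1).map f = q.1 := fun q hq =>
    hg _ fun x hx => hP2 q hq x ((h1 q hq).1 hx)
  have hg2 : ∀ q ∈ P, (g q.2).map f = q.2 := fun q hq => hg _ (hP2 q hq)
  have key : ∀ q ∈ P, ∀ F : Finset α,
      (g q.1 ⊆ F ∧ F ⊆ g q.2) ↔ (q.1 ⊆ F.map f ∧ F.map f ⊆ q.2) := fun q hq F => by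
    rw [← Finset.map_subset_map (f := f), hg1 q hq, ← Finset.map_subset_map (f := f), hg2 q hq]
  refine ⟨P.image fun q => (g q.1, g q.2), ?_, ?_, ?_⟩
  · intro q' hq'
    obtain ⟨q, hq, rfl⟩ := Finset.mem_image.1 hq'
    refine ⟨?_, ?_⟩
    · rw [← Finset.map_subset_map (f := f), hg1 q hq, hg2 q hq]
      exact (h1 q hq).1
    · rw [← Finset.card_map f, hg2 q hq]
      exact (h1 q hq).2
  · intro F
    simp only [Set.mem_ofPred_eq, h2, Finset.mem_image, exists_exists_and_eq_and]
    exact exists_congr fun q => and_congr_right fun hq => (key q hq F).symm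
  · intro F q' hq' r' hr' q1 q2 r1 r2
    obtain ⟨q, hq, rfl⟩ := Finset.mem_image.1 hq'
    obtain ⟨r, hr, rfl⟩ := Finset.mem_image.1 hr'
    have hq3 := (key q hq F).1 ⟨q1, q2⟩
    have hr3 := (key r hr F).1 ⟨r1, r2⟩
    rw [h3 _ q hq r hr hq3.1 hq3.2 hr3.1 hr3.2]

end IntervalPartition

/-! ### Independent and dependent sets of a path power -/

section PathPower

/-- The independent sets of the `k`-th power of the path on the vertices `a, …, b - 1`. -/
def pathIndepSets (k a b : ℕ) : Set (Finset ℕ) :=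
  {F | F ⊆ Finset.Ico a b ∧ ∀ i ∈ F, ∀ j ∈ F, i < j → i + k < j}

theorem pathIndepSets_finite (k a b : ℕ) : (pathIndepSets k a b).Finite :=
  (Finset.Ico a b).powerset.finite_toSet.subset fun _ hF => Finset.mem_coe.2 (Finset.mem_powerset.2 hF.1)

/-- The number `⌈m / (2k + 1)⌉`. -/
def pathDepth (k m : ℕ) : ℕ := (m + 2 * k) / (2 * k + 1)

theorem pathDepth_mono (k : ℕ) : Monotone (pathDepth k) := fun _ _ h =>
  Nat.div_le_div_right (by omega)

theorem pathDepth_add (k m : ℕ) : pathDepth k (m + (2 * k + 1)) = pathDepth k m + 1 := by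
  rw [pathDepth, add_right_comm, Nat.add_div_right _ (by omega), pathDepth]

/-- The exchange rate of both partitions: c vertices added to an upper end compensate for dropping
up to c(2k + 1) vertices of the path. -/
theorem pathDepth_le_of_le_add (k : ℕ) {m r : ℕ} (c : ℕ) (h : m ≤ r + c * (2 * k + 1)) :
    pathDepth k m ≤ pathDepth k r + c := by
  refine (pathDepth_mono k h).trans (le_of_eq ?_)
  clear h
  induction c with
  | zero => simp
  | succ c ih => rw [add_one_mul, ← add_assoc, pathDepth_add, ih, add_assoc]

theorem inter_Ico_mem_pathIndepSets {k c b : ℕ} {F : Finset ℕ} :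
    F ∩ Finset.Ico c b ∈ pathIndepSets k c b ↔
      ∀ i ∈ F, ∀ j ∈ F, c ≤ i → i < j → j < b → i + k < j := by
  refine ⟨fun h i hi j hj h1 h2 h3 => h.2 i ?_ j ?_ h2, fun h => ⟨Finset.inter_subset_right, ?_⟩⟩
  · exact Finset.mem_inter.2 ⟨hi, Finset.mem_Ico.2 (by omega)⟩
  · exact Finset.mem_inter.2 ⟨hj, Finset.mem_Ico.2 (by omega)⟩
  · intro i hi j hj hij
    simp only [Finset.mem_inter, Finset.mem_Ico] at hi hj
    exact h i hi.1 j hj.1 hi.2.1 hij hj.2.2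

/-- The sets in `pathIndepSets k a b` joined with an interval below `a`. -/
theorem HasIntervalPartition.pathIndepSets_join {k a b s : ℕ} {x y : Finset ℕ}
    (h : HasIntervalPartition (pathIndepSets k a b) s) (hxy : x ⊆ y) (hy : ∀ i ∈ y, i < a) :
    HasIntervalPartition
      {F | F ∩ Finset.Ico a b ∈ pathIndepSets k a b ∧ x ⊆ F ∧ F ⊆ y ∪ Finset.Ico a b}
      (s + y.card) := by
  refine h.join (fun F hF => hF.1) hxy (Finset.disjoint_left.2 fun i hi hi' => ?_)
  have := hy i hi
  have := (Finset.mem_Ico.1 hi').1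
  omega

/-- Only the empty set is too small to stand alone; the interval [∅, {a}] absorbs it. This is the
base case for short paths. -/
theorem hasIntervalPartition_pathIndepSets_one {k a b : ℕ} (hab : a < b) :
    HasIntervalPartition (pathIndepSets k a b) 1 := by
  have h1 : HasIntervalPartition {F : Finset ℕ | ∅ ⊆ F ∧ F ⊆ {a}} 1 := by
    simpa using hasIntervalPartition_Icc (Finset.empty_subset {a})
  have h2 : HasIntervalPartition {F | F ∈ pathIndepSets k a b ∧ ¬ F ⊆ {a}} 1 := by
    refine hasIntervalPartition_singletons ((pathIndepSets_finite k a b).subset fun F hF => hF.1) ?_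
    rintro F ⟨-, hF⟩
    refine Finset.one_le_card.2 (Finset.nonempty_iff_ne_empty.2 ?_)
    rintro rfl
    simp at hF
  convert h1.union h2 (Set.disjoint_left.2 fun F hF hF' => hF'.2 hF.2) using 1
  ext F
  simp only [Set.mem_union, Set.mem_ofPred_eq, Finset.empty_subset, true_and]
  constructor
  · tauto
  · rintro (h | h)
    · refine ⟨fun i hi => ?_, fun i hi j hj hij => ?_⟩
      · have := Finset.mem_singleton.1 (h hi)
        simp; omega
      · have := Finset.mem_singleton.1 (h hi)
        have := Finset.mem_singleton.1 (h hj)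
        omega
    · exact h.1

/-- The first vertex after `a, …, p` that is independent of `p`, and of `a + k` if `p = a`. -/
def pathIndepStart (k a p : ℕ) : ℕ := if p = a then a + 2 * k + 1 else p + k + 1

/-- A piece of `pathIndepSets k a b`: for `a ≤ p ≤ a + 2k` these pieces form a partition, and each
piece is a join of an interval with the independent sets of a shorter path. -/
def pathIndepPiece (k a b p : ℕ) : Set (Finset ℕ) :=
  {F | F ∩ Finset.Ico (pathIndepStart k a p) b ∈ pathIndepSets k (pathIndepStart k a p) b ∧
    (if p = a + k then ∅ else {p}) ⊆ F ∧
    F ⊆ (if a + k < p then {a, p} else {p}) ∪ Finset.Ico (pathIndepStart k a p) b}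

theorem mem_pathIndepPiece {k a b p : ℕ} {F : Finset ℕ} :
    F ∈ pathIndepPiece k a b p ↔
      (∀ i ∈ F, ∀ j ∈ F, pathIndepStart k a p ≤ i → i < j → j < b → i + k < j) ∧
      (p = a + k ∨ p ∈ F) ∧
      ∀ i ∈ F, (i = a ∧ a + k < p) ∨ i = p ∨ (pathIndepStart k a p ≤ i ∧ i < b) := by
  refine and_congr inter_Ico_mem_pathIndepSets (and_congr ?_ ?_)
  · split_ifs with h <;> simp [h]
  · refine forall₂_congr fun i _ => ?_
    rw [Finset.mem_union, Finset.mem_Ico]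
    split_ifs with h <;> simp [h, or_assoc]

/-- The independent sets of the `k`-th power of a path are partitioned into intervals whose largest
elements have at least `⌈m / (2k + 1)⌉` vertices, where `m` is the number of vertices. -/
theorem hasIntervalPartition_pathIndepSets {k : ℕ} (hk : 1 ≤ k) (a b : ℕ) :
    HasIntervalPartition (pathIndepSets k a b) (pathDepth k (b - a)) := by
  induction hm : b - a using Nat.strong_induction_on generalizing a with
  | _ m ih =>
  subst hm
  rcases Nat.eq_zero_or_pos (b - a) with h0 | h0
  · have : pathDepth k (b - a) = 0 := by
      rw [h0, pathDepth, Nat.div_eq_of_lt (by omega)]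
    rw [this]
    exact hasIntervalPartition_singletons (pathIndepSets_finite k a b) (by simp)
  rcases le_or_gt b (a + (2 * k + 1)) with hb | hb
  · refine (hasIntervalPartition_pathIndepSets_one (by omega)).mono ?_
    refine (pathDepth_le_of_le_add k (r := 0) 1 (by omega)).trans (le_of_eq ?_)
    rw [pathDepth, Nat.div_eq_of_lt (by omega)]
  -- Induction on the path starting at c, joined with the interval [x, y]: this is deep enough once
  -- |y|(2k + 1) covers the c - a vertices skipped.
  have hrec : ∀ c, a < c → ∀ x y : Finset ℕ, x ⊆ y → (∀ i ∈ y, i < c) →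
      b - a ≤ (b - c) + y.card * (2 * k + 1) → HasIntervalPartition
        {F | F ∩ Finset.Ico c b ∈ pathIndepSets k c b ∧ x ⊆ F ∧ F ⊆ y ∪ Finset.Ico c b}
        (pathDepth k (b - a)) := fun c hc x y hxy hy hcard =>
    ((ih (b - c) (by omega) c rfl).pathIndepSets_join hxy hy).mono
      (pathDepth_le_of_le_add k _ hcard)
  refine HasIntervalPartition.biUnion (Finset.Ico a (a + 2 * k + 1))
    (𝓖 := pathIndepPiece k a b) ?_ ?_ ?_
  · intro F
    constructor
    · rintro ⟨hF1, hF2⟩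
      replace hF1 : ∀ i ∈ F, a ≤ i ∧ i < b := fun i hi => Finset.mem_Ico.1 (hF1 hi)
      have hmem : ∀ p, a ≤ p → p < a + 2 * k + 1 → (p = a + k ∨ p ∈ F) →
          (∀ i ∈ F, (i = a ∧ a + k < p) ∨ i = p ∨ pathIndepStart k a p ≤ i) →
          ∃ p ∈ Finset.Ico a (a + 2 * k + 1), F ∈ pathIndepPiece k a b p := by
        intro p hp1 hp2 hp3 hp4
        refine ⟨p, Finset.mem_Ico.2 ⟨hp1, hp2⟩, mem_pathIndepPiece.2
          ⟨fun i hi j hj _ hij _ => hF2 i hi j hj hij, hp3, fun i hi => ?_⟩⟩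
        have := hp4 i hi
        have := hF1 i hi
        omega
      -- The order of the cases selects p. A vertex strictly between a and a + k excludes everything
      -- else up to p + k. A vertex p beyond a + k tolerates only a before it. Otherwise F meets the
      -- first 2k + 1 vertices in at most one of a and a + k; if a is absent, a + k is optional.
      by_cases h1 : ∃ p ∈ F, a < p ∧ p < a + k
      · obtain ⟨p, hp, hp1, hp2⟩ := h1
        refine hmem p (by omega) (by omega) (Or.inr hp) fun i hi => ?_
        have := hF1 i hi
        have := hF2 i hi p hp
        have := hF2 p hp i hi
        rw [pathIndepStart, if_neg (by omega)]
        omega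
      by_cases h2 : ∃ p ∈ F, a + k < p ∧ p < a + 2 * k + 1
      · obtain ⟨p, hp, hp1, hp2⟩ := h2
        refine hmem p (by omega) (by omega) (Or.inr hp) fun i hi => ?_
        have := hF1 i hi
        have := hF2 i hi p hp
        have := hF2 p hp i hi
        have : ¬ (a < i ∧ i < a + k) := fun h => h1 ⟨i, hi, h⟩
        rw [pathIndepStart, if_neg (by omega)]
        omega
      have h12 : ∀ i ∈ F, i = a ∨ i = a + k ∨ a + 2 * k + 1 ≤ i := fun i hi => by
        have : ¬ (a < i ∧ i < a + k) := fun h => h1 ⟨i, hi, h⟩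
        have : ¬ (a + k < i ∧ i < a + 2 * k + 1) := fun h => h2 ⟨i, hi, h⟩
        have := hF1 i hi
        omega
      by_cases h3 : a ∈ F
      · refine hmem a le_rfl (by omega) (Or.inr h3) fun i hi => ?_
        have := h12 i hi
        have := hF2 a h3 i hi
        rw [pathIndepStart, if_pos rfl]
        omega
      · refine hmem (a + k) (by omega) (by omega) (Or.inl rfl) fun i hi => ?_
        have := h12 i hi
        have : i ≠ a := fun h => h3 (h ▸ hi)
        rw [pathIndepStart, if_neg (by omega)]
        omega
    · rintro ⟨p, hp, h⟩
      rw [Finset.mem_Ico] at hp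
      obtain ⟨h1, -, h4⟩ := mem_pathIndepPiece.1 h
      refine ⟨fun i hi => ?_, fun i hi j hj hij => ?_⟩
      · have := h4 i hi
        rw [Finset.mem_Ico]
        unfold pathIndepStart at *
        split_ifs at * <;> omega
      · have := h4 i hi
        have := h4 j hj
        have := h1 i hi j hj
        clear h4 h1 h hrec
        unfold pathIndepStart at *
        split_ifs at * <;> omega
  · intro F p hp q hq h1 h2
    rw [Finset.mem_Ico] at hp hq
    obtain ⟨-, h1, h1'⟩ := mem_pathIndepPiece.1 h1
    obtain ⟨-, h2, h2'⟩ := mem_pathIndepPiece.1 h2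
    have h3 : q = a + k ∨ (q = a ∧ a + k < p) ∨ q = p ∨ pathIndepStart k a p ≤ q :=
      h2.imp_right fun h => (h1' q h).imp_right (Or.imp_right And.left)
    have h4 : p = a + k ∨ (p = a ∧ a + k < q) ∨ p = q ∨ pathIndepStart k a q ≤ p :=
      h1.imp_right fun h => (h2' p h).imp_right (Or.imp_right And.left)
    unfold pathIndepStart at h3 h4
    split_ifs at h3 h4 <;> omega
  · intro p hp
    rw [Finset.mem_Ico] at hp
    refine hrec _ ?_ _ _ ?_ ?_ ?_
    · unfold pathIndepStart
      split_ifs <;> omega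
    · split_ifs <;> simp
    · intro i
      unfold pathIndepStart
      split_ifs <;> simp <;> omega
    · have h2 : a + k < p → ({a, p} : Finset ℕ).card = 2 := fun h =>
        Finset.card_pair (by omega)
      unfold pathIndepStart
      split_ifs <;> simp_all <;> omega


/-- The sets containing an edge of the `k`-th power of a path on `n` vertices are partitioned into
intervals whose largest elements have at least `⌈n / (2k + 1)⌉ + 1` vertices. -/
theorem hasIntervalPartition_pathDepSets {k : ℕ} (hk : 1 ≤ k) (n : ℕ) :
    HasIntervalPartition
      {F | F ⊆ Finset.range n ∧ ∃ i ∈ F, ∃ j ∈ F, i < j ∧ j ≤ i + k} (pathDepth k n + 1) := by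
  refine HasIntervalPartition.biUnion
    ((Finset.range n ×ˢ Finset.range n).filter fun p => p.1 < p.2 ∧ p.2 ≤ p.1 + k)
    (𝓖 := fun p => {F | F ∩ Finset.Ico (p.2 + k + 1) n ∈ pathIndepSets k (p.2 + k + 1) n ∧
      {p.1, p.2} ⊆ F ∧ F ⊆ insert p.2 (Finset.range (p.1 + 1)) ∪ Finset.Ico (p.2 + k + 1) n})
    ?_ ?_ ?_
  · intro F
    simp only [Finset.mem_filter, Finset.mem_product, Finset.mem_range, Set.mem_ofPred_eq,
      inter_Ico_mem_pathIndepSets, Prod.exists, Finset.insert_subset_iff,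
      Finset.singleton_subset_iff]
    constructor
    · rintro ⟨hF, i, hi, j, hj, hij, hji⟩
      -- The piece of F is given by its edge with the largest left end.
      obtain ⟨d, hd, hmax⟩ := Finset.exists_max_image
        (F.filter fun i => ∃ j ∈ F, i < j ∧ j ≤ i + k) id
        ⟨i, Finset.mem_filter.2 ⟨hi, j, hj, hij, hji⟩⟩
      obtain ⟨hd, e, he, hde, hek⟩ := Finset.mem_filter.1 hd
      have hmax' : ∀ i ∈ F, ∀ j ∈ F, d < i → i < j → i + k < j := fun i hi j hj h1 h2 => by
        by_contra h3
        have : i ≤ d := hmax i (Finset.mem_filter.2 ⟨hi, j, hj, h2, by omega⟩)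
        omega
      have hFn : ∀ i ∈ F, i < n := fun i hi => Finset.mem_range.1 (hF hi)
      refine ⟨d, e, ⟨⟨hFn d hd, hFn e he⟩, hde, hek⟩,
        fun i hi j hj h1 h2 _ => hmax' i hi j hj (by omega) h2, ⟨hd, he⟩, fun i hi => ?_⟩
      have := hFn i hi
      have := hmax' i hi e he
      have := hmax' e he i hi
      simp only [Finset.mem_union, Finset.mem_insert, Finset.mem_range, Finset.mem_Ico]
      omega
    · rintro ⟨d, e, ⟨⟨hd, he⟩, hde, hek⟩, -, ⟨hdF, heF⟩, hF⟩
      refine ⟨fun i hi => ?_, d, hdF, e, heF, hde, hek⟩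
      have := hF hi
      simp only [Finset.mem_union, Finset.mem_insert, Finset.mem_range, Finset.mem_Ico] at *
      omega
  · have aux : ∀ (F : Finset ℕ) (i d j e : ℕ), i < d → d ≤ i + k → j < e → e ≤ j + k →
        F ∩ Finset.Ico (d + k + 1) n ∈ pathIndepSets k (d + k + 1) n →
        F ⊆ insert d (Finset.range (i + 1)) ∪ Finset.Ico (d + k + 1) n →
        j ∈ F → e ∈ F → j ≤ i ∧ (i = j → e = d) := by
      intro F i d j e hid hdk hje hek h1 hF hj he
      have h2 := hF hj
      have h3 := hF he
      rw [inter_Ico_mem_pathIndepSets] at h1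
      have := h1 j hj e he
      simp only [Finset.mem_union, Finset.mem_insert, Finset.mem_range, Finset.mem_Ico] at h2 h3
      omega
    rintro F ⟨i, d⟩ hi ⟨j, e⟩ hj ⟨h1, h2, h3⟩ ⟨h4, h5, h6⟩
    simp only [Finset.mem_filter, Finset.mem_product, Finset.mem_range, Finset.insert_subset_iff,
      Finset.singleton_subset_iff] at *
    have := aux F i d j e (by omega) (by omega) (by omega) (by omega) h1 h3 h5.1 h5.2
    have := aux F j e i d (by omega) (by omega) (by omega) (by omega) h4 h6 h2.1 h2.2
    rw [Prod.mk.injEq]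
    omega
  · rintro ⟨j, d⟩ h
    simp only [Finset.mem_filter, Finset.mem_product, Finset.mem_range] at h
    refine ((hasIntervalPartition_pathIndepSets hk (d + k + 1) n).pathIndepSets_join
      (x := {j, d}) (y := insert d (Finset.range (j + 1))) ?_ ?_).mono ?_
    · intro i
      simp; omega
    · intro i
      simp; omega
    · rw [Finset.card_insert_of_notMem (by simp; omega), Finset.card_range]
      -- At most d + k + 1 ≤ j + 2k + 1 ≤ (j + 1)(2k + 1) vertices are cut off, so j + 1 of the j +
      -- 2 vertices pay for them and one is left over: the summand + 1 of the bound.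
      have := pathDepth_le_of_le_add k (m := n) (r := n - (d + k + 1)) (j + 1) (by
        have : j * 1 ≤ j * (2 * k + 1) := Nat.mul_le_mul_left _ (by omega)
        rw [add_one_mul]; omega)
      omega

end PathPower

/-! ### From supports to Stanley decompositions -/

section Algebra

open MvPolynomial

variable {K : Type*} [Field K] {n : ℕ}

theorem mem_edgeIdeal {G : SimpleGraph (Fin n)} {p : MvPolynomial (Fin n) K} :
    p ∈ edgeIdeal K G ↔ ∀ m ∈ p.support, ∃ i j, G.Adj i j ∧ i ∈ m.support ∧ j ∈ m.support := by
  have : edgeIdeal K G = Ideal.span ((fun m => monomial m (1 : K)) ''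
      {m | ∃ i j, G.Adj i j ∧ m = Finsupp.single i 1 + Finsupp.single j 1}) := by
    rw [edgeIdeal]
    congr 1
    ext p
    simp only [Set.mem_ofPred_eq, Set.mem_image, X, monomial_mul, one_mul]
    constructor
    · rintro ⟨i, j, h, rfl⟩
      exact ⟨_, ⟨i, j, h, rfl⟩, rfl⟩
    · rintro ⟨_, ⟨i, j, h, rfl⟩, rfl⟩
      exact ⟨i, j, h, rfl⟩
  rw [this, mem_ideal_span_monomial_image]
  refine forall₂_congr fun m _ => ?_
  simp only [Set.mem_ofPred_eq, Finsupp.mem_support_iff]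
  constructor
  · rintro ⟨_, ⟨i, j, h, rfl⟩, hle⟩
    have hi := hle i
    have hj := hle j
    simp only [Finsupp.add_apply, Finsupp.single_eq_same] at hi hj
    exact ⟨i, j, h, by omega, by omega⟩
  · rintro ⟨i, j, h, hi, hj⟩
    refine ⟨_, ⟨i, j, h, rfl⟩, fun l => ?_⟩
    -- Without loops the generators are squarefree, so divisibility depends only on the support.
    have hij := h.ne
    simp only [Finsupp.add_apply, Finsupp.single_apply]
    split_ifs with h1 h2 h2
    · exact absurd (h1.trans h2.symm) hij
    · subst h1; omega
    · subst h2; omega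
    · simp

/-- The exponent of the squarefree monomial with support `A`. -/
noncomputable def squarefreeExponent (A : Finset (Fin n)) : Fin n →₀ ℕ :=
  Finsupp.equivFunOnFinite.symm fun i => if i ∈ A then 1 else 0

theorem squarefreeExponent_apply (A : Finset (Fin n)) (i : Fin n) :
    squarefreeExponent A i = if i ∈ A then 1 else 0 := rfl

theorem support_squarefreeExponent (A : Finset (Fin n)) : (squarefreeExponent A).support = A := by
  ext i
  simp [squarefreeExponent_apply]

theorem support_add_squarefreeExponent (m : Fin n →₀ ℕ) (A : Finset (Fin n)) :
    (m + squarefreeExponent A).support = m.support ∪ A := by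
  ext i
  simp [squarefreeExponent_apply]
  tauto

section Ideal

variable {I : Ideal (MvPolynomial (Fin n) K)}

theorem support_of_mem_stanleySpace {A B : Finset (Fin n)} (hAB : A ⊆ B)
    (hA : monomial (squarefreeExponent A) (1 : K) ∈ I) {x : I}
    (hx : x ∈ stanleySpace (K := K) (⟨_, hA⟩ : I) B) :
    ∀ m ∈ x.1.support, A ⊆ m.support ∧ m.support ⊆ B := by
  have : stanleySpace (K := K) (⟨_, hA⟩ : I) B ≤
      (restrictSupport K {m | A ⊆ m.support ∧ m.support ⊆ B}).comap
        ((Submodule.subtype I).restrictScalars K) := by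
    refine Submodule.span_le.2 ?_
    rintro _ ⟨m, hm, rfl⟩
    change monomial m 1 * monomial (squarefreeExponent A) 1 ∈ restrictSupport K _
    rw [monomial_mul, monomial_mem_restrictSupport]
    left
    rw [Set.mem_ofPred_eq, support_add_squarefreeExponent]
    exact ⟨Finset.subset_union_right, Finset.union_subset hm hAB⟩
  exact this hx

theorem monomial_mem_stanleySpace {A B : Finset (Fin n)}
    (hA : monomial (squarefreeExponent A) (1 : K) ∈ I) {m : Fin n →₀ ℕ} (hAm : A ⊆ m.support)
    (hmB : m.support ⊆ B) (c : K) (hm : monomial m c ∈ I) :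
    (⟨_, hm⟩ : I) ∈ stanleySpace (K := K) (⟨_, hA⟩ : I) B := by
  have hle : squarefreeExponent A ≤ m := fun i => by
    rw [squarefreeExponent_apply]
    split_ifs with h
    · have := Finsupp.mem_support_iff.1 (hAm h)
      omega
    · simp
  have : (⟨_, hm⟩ : I) = c • (monomial (m - squarefreeExponent A) (1 : K) • (⟨_, hA⟩ : I)) := by
    refine Subtype.ext ?_
    change monomial m c = c • (monomial (m - squarefreeExponent A) (1 : K) *
      monomial (squarefreeExponent A) 1)
    rw [monomial_mul, tsub_add_cancel_of_le hle, smul_monomial]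
    simp
  rw [this]
  refine Submodule.smul_mem _ _ (Submodule.subset_span ⟨_, ?_, rfl⟩)
  exact (Finsupp.support_tsub).trans hmB

/-- An interval partition of the supports of the monomials of a squarefree monomial ideal induces a
Stanley decomposition of the ideal. -/
theorem HasIntervalPartition.le_stanleyDepth {𝓕 : Set (Finset (Fin n))} {s : ℕ}
    (h : HasIntervalPartition 𝓕 s)
    (hI : ∀ p : MvPolynomial (Fin n) K, p ∈ I ↔ ∀ m ∈ p.support, m.support ∈ 𝓕) :
    (s : ℕ∞) ≤ stanleyDepth (idealGrading I) := by
  classical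
  obtain ⟨P, h1, h2, h3⟩ := h
  have hmon : ∀ (m : Fin n →₀ ℕ) (c : K), m.support ∈ 𝓕 → monomial m c ∈ I := by
    intro m c hm
    rw [hI]
    intro m' hm'
    rwa [Finset.mem_singleton.1 (support_monomial_subset hm')]
  have hP : ∀ q ∈ P, monomial (squarefreeExponent q.1) (1 : K) ∈ I := fun q hq => by
    refine hmon _ _ ?_
    rw [support_squarefreeExponent]
    exact (h2 _).2 ⟨q, hq, subset_rfl, (h1 q hq).1⟩
  let e : Fin P.card ≃ P := P.equivFin.symm
  let v : Fin P.card → I := fun i => ⟨_, hP (e i).1 (e i).2⟩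
  let W : Fin P.card → Finset (Fin n) := fun i => (e i).1.2
  have hsupp : ∀ i, ∀ x ∈ stanleySpace (K := K) (v i) (W i), ∀ m ∈ x.1.support,
      (e i).1.1 ⊆ m.support ∧ m.support ⊆ (e i).1.2 := fun i x hx =>
    support_of_mem_stanleySpace (h1 _ (e i).2).1 _ hx
  have hint : DirectSum.IsInternal fun i => stanleySpace (K := K) (v i) (W i) := by
    rw [DirectSum.isInternal_submodule_iff_iSupIndep_and_iSup_eq_top]
    constructor
    · intro i
      rw [Submodule.disjoint_def]
      intro x hx hx'
      -- The supports of monomials in distinct Stanley spaces lie in disjoint intervals, so no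
      -- monomial can occur in both a space and the sum of the others.
      have hle : (⨆ j, ⨆ (_ : j ≠ i), stanleySpace (K := K) (v j) (W j)) ≤
          (restrictSupport K {m | ∃ j, j ≠ i ∧ (e j).1.1 ⊆ m.support ∧
            m.support ⊆ (e j).1.2}).comap ((Submodule.subtype I).restrictScalars K) :=
        iSup₂_le fun j hj y hy m hm => ⟨j, hj, hsupp j y hy m hm⟩
      have hx0 : x.1.support = ∅ := by
        refine Finset.eq_empty_of_forall_notMem fun m hm => ?_
        obtain ⟨j, hj, hj1, hj2⟩ := hle hx' hm
        obtain ⟨hi1, hi2⟩ := hsupp i x hx m hm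
        exact hj (e.injective (Subtype.ext
          (h3 _ _ (e j).2 _ (e i).2 hj1 hj2 hi1 hi2)))
      exact Subtype.ext (support_eq_empty.1 hx0)
    · rw [eq_top_iff]
      rintro ⟨p, hp⟩ -
      have hterm : ∀ m ∈ p.support, m.support ∈ 𝓕 := (hI p).1 hp
      have hsum : (⟨p, hp⟩ : I) = ∑ m ∈ p.support.attach,
          ⟨monomial m.1 (p.coeff m.1), hmon _ _ (hterm m.1 m.2)⟩ := by
        refine Subtype.ext ?_
        rw [AddSubmonoidClass.coe_finsetSum, Finset.sum_attach p.support
          (fun m => monomial m (p.coeff m))]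
        exact p.as_sum
      rw [hsum]
      refine Submodule.sum_mem _ fun m _ => ?_
      obtain ⟨q, hq, hq1, hq2⟩ := (h2 _).1 (hterm m.1 m.2)
      refine Submodule.mem_iSup_of_mem (e.symm ⟨q, hq⟩) ?_
      have he : e (e.symm ⟨q, hq⟩) = ⟨q, hq⟩ := e.apply_symm_apply _
      refine monomial_mem_stanleySpace _ ?_ ?_ _ _
      · rw [he]; exact hq1
      · simp only [W]; rw [he]; exact hq2
  let D : StanleyDecomposition (idealGrading I) :=
    { s := P.card
      v := v
      W := W
      homogeneous := fun i => ⟨fun j => (squarefreeExponent (e i).1.1 j : ℤ),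
        Submodule.subset_span ⟨_, fun _ => rfl, rfl⟩⟩
      free := by
        intro i p _ hp
        have hp' : p * monomial (squarefreeExponent (e i).1.1) (1 : K) = 0 :=
          congrArg Subtype.val hp
        refine (mul_eq_zero.1 hp').resolve_right ?_
        simp [monomial_eq_zero]
      isInternal := hint }
  calc (s : ℕ∞) ≤ D.sdepth := le_iInf fun i => by
        exact_mod_cast (h1 _ (e i).2).2
    _ ≤ _ := le_iSup StanleyDecomposition.sdepth D

end Ideal

/-! ### Upper bound for the quotient -/

section Quotient

/-- Elements of a homogeneous component of `K[x₁, …, xₙ]` are multiples of one monomial. -/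
theorem eq_monomial_of_mem_polyGrading {a : Fin n → ℤ} {p : MvPolynomial (Fin n) K}
    (hp : p ∈ polyGrading K n a) :
    ∃ (m : Fin n →₀ ℕ) (c : K), p = monomial m c := by
  let m : Fin n →₀ ℕ := Finsupp.equivFunOnFinite.symm fun i => (a i).toNat
  have hle : polyGrading K n a ≤ restrictSupport K {m} := by
    refine Submodule.span_le.2 ?_
    rintro _ ⟨m', hm', rfl⟩
    refine (monomial_mem_restrictSupport K).2 (Or.inl (Finsupp.ext fun i => ?_))
    have := hm' i
    simp only [m, Finsupp.equivFunOnFinite_symm_apply_apply]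
    omega
  refine ⟨m, p.coeff m, ?_⟩
  ext m'
  rw [coeff_monomial]
  split_ifs with h
  · rw [h]
  · by_contra h0
    exact h (Set.mem_singleton_iff.1 (hle hp (mem_support_iff.2 h0))).symm

/-- A monomial `u` outside of an ideal `I` that is spanned by monomials bounds the Stanley depth of
the quotient by the number of variables `x` with `x u` outside of `I`. -/
theorem stanleyDepth_quotient_le {I : Ideal (MvPolynomial (Fin n) K)} {u : Fin n →₀ ℕ}
    {A : Finset (Fin n)} (hu : ∀ p ∈ I, p.coeff u = 0)
    (hA : ∀ j ∉ A, monomial (Finsupp.single j 1 + u) (1 : K) ∈ I) :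
    stanleyDepth (quotientGrading I) ≤ A.card := by
  refine iSup_le fun D => ?_
  -- Taking the coefficient of u descends to S/I; it detects a Stanley space that reaches u.
  let φ : (MvPolynomial (Fin n) K ⧸ I) →ₗ[K] K :=
    (I.restrictScalars K).liftQ (lcoeff K u) fun p hp => hu p hp
  have hφ : ∀ p : MvPolynomial (Fin n) K, φ (Submodule.Quotient.mk p) = p.coeff u := fun p => rfl
  have hex : ∃ i, ∃ m : Fin n →₀ ℕ, m.support ⊆ D.W i ∧
      φ (monomial m (1 : K) • D.v i) ≠ 0 := by
    by_contra! hne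
    have htop := D.isInternal.submodule_iSup_eq_top
    have hle : (⨆ i, stanleySpace (K := K) (D.v i) (D.W i)) ≤ LinearMap.ker φ := by
      refine iSup_le fun i => Submodule.span_le.2 ?_
      rintro _ ⟨m, hm, rfl⟩
      exact hne i m hm
    have hmem : (Submodule.Quotient.mk (monomial u 1) : MvPolynomial (Fin n) K ⧸ I) ∈
        LinearMap.ker φ := hle (htop ▸ Submodule.mem_top)
    rw [LinearMap.mem_ker, hφ, coeff_monomial, if_pos rfl] at hmem
    exact one_ne_zero hmem
  obtain ⟨i, m, hm, hne⟩ := hex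
  refine (iInf_le _ i).trans (Nat.cast_le.2 (Finset.card_le_card fun j hj => ?_))
  by_contra hjA
  obtain ⟨a, p, hp, hpv⟩ := D.homogeneous i
  obtain ⟨b, c, rfl⟩ := eq_monomial_of_mem_polyGrading hp
  replace hpv : D.v i = Submodule.Quotient.mk (monomial b c) := hpv.symm
  rw [hpv, ← Submodule.Quotient.mk_smul, hφ, smul_eq_mul, monomial_mul, coeff_monomial] at hne
  have hmb : m + b = u := by
    by_contra h
    simp [h] at hne
  -- Were j ∉ A in the variable set, the monomial x_j x^m would kill the generator, since x_j u ∈ I;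
  -- this contradicts freeness.
  have hkill : monomial (Finsupp.single j 1 + m) (1 : K) • D.v i = 0 := by
    rw [hpv, ← Submodule.Quotient.mk_smul, Submodule.Quotient.mk_eq_zero, smul_eq_mul,
      monomial_mul, add_assoc, hmb]
    have := I.mul_mem_left (C c) (hA j hjA)
    rwa [C_mul_monomial, mul_one, ← one_mul c] at this
  have hzero := D.free i _ ?_ hkill
  · simp [monomial_eq_zero] at hzero
  · rw [mem_supported, vars_monomial one_ne_zero]
    intro l hl
    rcases Finset.mem_union.1 (Finsupp.support_add hl) with h | h
    · have := Finsupp.support_single_subset h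
      rw [Finset.mem_singleton.1 this]
      exact hj
    · exact hm h

end Quotient

/-! ### Application to the edge ideal of a path power -/

section PathPower

theorem pathDepth_add_one_le_stanleyDepth (K : Type*) [Field K] (n : ℕ) {k : ℕ} (hk : 1 ≤ k) :
    ((pathDepth k n + 1 : ℕ) : ℕ∞) ≤
      stanleyDepth (idealGrading (edgeIdeal K (pathPower n k))) := by
  refine ((hasIntervalPartition_pathDepSets hk n).comap Fin.valEmbedding ?_).le_stanleyDepth
    fun p => ?_
  · rintro F ⟨hF, -⟩ x hx
    exact ⟨⟨x, Finset.mem_range.1 (hF hx)⟩, rfl⟩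
  · rw [mem_edgeIdeal]
    refine forall₂_congr fun m _ => ?_
    simp only [Set.mem_ofPred_eq, Finset.mem_map, Fin.valEmbedding_apply]
    constructor
    · rintro ⟨i, j, h | h, hi, hj⟩
      · refine ⟨fun x hx => ?_, i, ⟨i, hi, rfl⟩, j, ⟨j, hj, rfl⟩, h⟩
        obtain ⟨y, -, rfl⟩ := Finset.mem_map.1 hx
        exact Finset.mem_range.2 y.2
      · refine ⟨fun x hx => ?_, j, ⟨j, hj, rfl⟩, i, ⟨i, hi, rfl⟩, h⟩
        obtain ⟨y, -, rfl⟩ := Finset.mem_map.1 hx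
        exact Finset.mem_range.2 y.2
    · rintro ⟨-, _, ⟨i, hi, rfl⟩, _, ⟨j, hj, rfl⟩, h⟩
      exact ⟨i, j, Or.inl h, hi, hj⟩

/-- The `k`-th power of the path on `n` vertices has an independent dominating set with at most
`⌈n / (2k + 1)⌉` vertices. -/
theorem exists_independent_dominating (n k : ℕ) :
    ∃ A : Finset (Fin n), A.card ≤ pathDepth k n ∧
      (∀ i ∈ A, ∀ j ∈ A, ¬ (pathPower n k).Adj i j) ∧
      ∀ j ∉ A, ∃ i ∈ A, (pathPower n k).Adj j i := by
  classical
  rcases Nat.eq_zero_or_pos n with rfl | hn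
  · exact ⟨∅, by simp, by simp, fun j => j.elim0⟩
  -- Centres of consecutive blocks of 2k + 1 vertices; the minimum moves the last centre back to the
  -- last vertex if its block is too short.
  let c : ℕ → Fin n := fun i => ⟨min (n - 1) (i * (2 * k + 1) + k), by omega⟩
  have hc : ∀ i, (c i).val = min (n - 1) (i * (2 * k + 1) + k) := fun i => rfl
  have hlt : ∀ i, i < pathDepth k n ↔ i * (2 * k + 1) < n := fun i => by
    rw [pathDepth, Nat.lt_iff_add_one_le, Nat.le_div_iff_mul_le (by omega), add_one_mul]
    omega
  have hfar : ∀ i j, i < j → j < pathDepth k n → (c i).val + k < (c j).val := by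
    intro i j hij hj
    have h1 := (hlt j).1 hj
    have h2 : (i + 1) * (2 * k + 1) ≤ j * (2 * k + 1) := Nat.mul_le_mul_right _ hij
    rw [add_one_mul] at h2
    rw [hc, hc]
    omega
  refine ⟨(Finset.range (pathDepth k n)).image c, ?_, ?_, ?_⟩
  · exact Finset.card_image_le.trans (Finset.card_range _).le
  · intro x hx y hy h
    obtain ⟨i, hi, rfl⟩ := Finset.mem_image.1 hx
    obtain ⟨j, hj, rfl⟩ := Finset.mem_image.1 hy
    rw [Finset.mem_range] at hi hj
    rcases lt_trichotomy i j with hij | rfl | hij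
    · have := hfar i j hij hj
      rcases h with h | h <;> omega
    · exact h.ne rfl
    · have := hfar j i hij hi
      rcases h with h | h <;> omega
  · intro j hj
    have h1 : j.val / (2 * k + 1) * (2 * k + 1) ≤ j.val := Nat.div_mul_le_self _ _
    have h2 : j.val < j.val / (2 * k + 1) * (2 * k + 1) + (2 * k + 1) :=
      Nat.lt_div_mul_add (by omega)
    have hmem : c (j.val / (2 * k + 1)) ∈ (Finset.range (pathDepth k n)).image c :=
      Finset.mem_image_of_mem _ (Finset.mem_range.2 ((hlt _).2 (by omega)))
    refine ⟨_, hmem, ?_⟩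
    have hne : j.val ≠ (c (j.val / (2 * k + 1))).val := fun h => hj (Fin.ext h ▸ hmem)
    have hjn := j.2
    change (_ ∧ _) ∨ (_ ∧ _)
    rw [hc] at hne ⊢
    omega

theorem stanleyDepth_quotient_edgeIdeal_pathPower_le (K : Type*) [Field K] (n k : ℕ) :
    stanleyDepth (quotientGrading (edgeIdeal K (pathPower n k))) ≤ (pathDepth k n : ℕ) := by
  obtain ⟨A, hcard, hind, hdom⟩ := exists_independent_dominating n k
  refine (stanleyDepth_quotient_le (u := squarefreeExponent A) (A := A) ?_ ?_).trans
    (Nat.cast_le.2 hcard)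
  · intro p hp
    by_contra h
    obtain ⟨i, j, hij, hi, hj⟩ := mem_edgeIdeal.1 hp _ (mem_support_iff.2 h)
    rw [support_squarefreeExponent] at hi hj
    exact hind i hi j hj hij
  · intro j hj
    obtain ⟨i, hi, hji⟩ := hdom j hj
    refine mem_edgeIdeal.2 fun m hm => ?_
    rw [Finset.mem_singleton.1 (support_monomial_subset hm), support_add_squarefreeExponent]
    exact ⟨j, i, hji, by simp, by simp [hi]⟩

theorem natCeil_div_eq_pathDepth (n k : ℕ) : ⌈(n : ℚ) / (2 * (k : ℚ) + 1)⌉₊ = pathDepth k n := by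
  have hpos : (0 : ℚ) < 2 * (k : ℚ) + 1 := by positivity
  refine eq_of_forall_ge_iff fun c => ?_
  rw [Nat.ceil_le, div_le_iff₀ hpos, pathDepth, Nat.div_le_iff_le_mul_add_pred (by omega)]
  have : (n : ℚ) ≤ c * (2 * k + 1) ↔ n ≤ c * (2 * k + 1) := by exact_mod_cast Iff.rfl
  rw [this, mul_comm]
  omega

end PathPower

end Algebra

end StanleyDepth

theorem theorem5p2 (K : Type*) [Field K] (n k : ℕ) (hn : 2 ≤ n) (hk : 1 ≤ k) :
    ((⌈(n : ℚ) / (2 * (k : ℚ) + 1)⌉₊ + 1 : ℕ) : ℕ∞) ≤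
        StanleyDepth.stanleyDepth
          (StanleyDepth.idealGrading (StanleyDepth.edgeIdeal K (StanleyDepth.pathPower n k))) ∧
      StanleyDepth.stanleyDepth
          (StanleyDepth.quotientGrading (StanleyDepth.edgeIdeal K (StanleyDepth.pathPower n k))) ≤
        StanleyDepth.stanleyDepth
          (StanleyDepth.idealGrading (StanleyDepth.edgeIdeal K (StanleyDepth.pathPower n k))) := by
  have h := StanleyDepth.pathDepth_add_one_le_stanleyDepth K n hk
  rw [StanleyDepth.natCeil_div_eq_pathDepth]
  refine ⟨h, (StanleyDepth.stanleyDepth_quotient_edgeIdeal_pathPower_le K n k).trans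
    (le_trans ?_ h)⟩
  exact_mod_cast Nat.le_succ _
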